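/- All vector spaces are real. A scale Banach space (Banach scale) $E$ is a Banach space $E=E_0$ with a nested sequence of linear subspaces $E_0\supset E_1\supset E_2\supset\cdots$ (levels), each a Banach space under its own norm, such that all inclusions $E_{m+1}\hookrightarrow E_m$ are compact linear operators and $E_\infty:=\bigcap_m E_m$ is dense in every $E_m$. Direct sums are formed levelwise, $(E\oplus F)_m=E_m\oplus F_m$, and $E^k$ denotes the shifted scale with levels $(E^k)_m=E_{m+k}$. An sc-isomorphism between Banach scales is a linear bijection of the top levels which restricts, for every $m$, to a linear homeomorphism of the levels $m$. A partial quadrant in $E$ is a set $C\subset E$ for which there are $n\in\mathbb{N}_0$, a Banach scale $W$ and an sc-isomorphism $T\colon E\to\mathbb{R}^n\oplus W$ (with $\mathbb{R}^n$ the constant scale) such that $T(C)=[0,\infty)^n\oplus W$. An sc-triple $(U,C,E)$ consists of a Banach scale $E$, a partial quadrant $C\subset E$ and a relatively open subset $U\subset C$; put $U_m:=U\cap E_m$. (The case $C=E$ is that of an open subset $U$ of $E$.) Differentiability of a map on $U_m\subset E_m$ is Fréchet differentiability relative to $U_m$, i.e. with increments $h\in E_m$ such that $x+h\in U_m$. Let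 $(U,C,E)$ and $(V,D,F)$ be sc-triples. A map $f\colon U\to V$ is of class $\mathrm{sc}^0$ if, for every $m\in\mathbb{N}_0$, $f(U_m)\subset V_m$ and $f\colon U_m\to V_m$ is continuous with respect to the topologies of $E_m$ and $F_m$. The tangent bundle $TU:=U^1\oplus E^0$ is the subset of the Banach scale $TE:=E^1\oplus E^0$ with levels $(TU)_m=U_{m+1}\oplus E_m$; with $TC:=C^1\oplus E^0$, $(TU,TC,TE)$ is again an sc-triple. An $\mathrm{sc}^0$ map $f$ is of class $\mathrm{sc}^1$ if $f\colon U_1\to F_0$ is differentiable at every point $x\in U_1$, its derivative $df(x)\in\mathcal{L}(E_1,F_0)$ extends to a bounded linear operator $Df(x)\in\mathcal{L}(E_0,F_0)$, and the tangent map $Tf\colon TU\to TV$, $Tf(x,\xi)=(f(x),Df(x)\xi)$, is of class $\mathrm{sc}^0$. An $\mathrm{sc}^1$ map $f$ is of class $\mathrm{sc}^2$ if $Tf\colon TU\to TV$ is of class $\mathrm{sc}^1$. **Lemma.** Let $f\colon U\to V$ be of class $\mathrm{sc}^1$. Then $f$ is of class $\mathrm{sc}^2$ if and only if the following three conditions hold.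 (a) The restriction $f\colon U_2\to F_0$ is pointwise twice differentiable: it is differentiable at every point of $U_2$, and so is the map $df\colon U_2\to\mathcal{L}(E_2,F_0)$, where $\mathcal{L}(E_2,F_0)$ carries the operator norm. (b) For every $x\in U_2$ the second derivative $d^2f(x)$, a continuous bilinear map $E_2\oplus E_2\to F_0$, has a (necessarily unique) continuous bilinear extension $D^2f(x)\colon E_1\oplus E_1\to F_0$. (c) For all $m\in\mathbb{N}_0$ and $x\in U_{m+2}$ the map $D^2f(x)$ restricts to a continuous bilinear map $E_{m+1}\oplus E_{m+1}\to F_m$, and the map $$U_{m+2}\oplus E_{m+1}\oplus E_{m+1}\to F_m,\qquad (x,\xi_1,\xi_2)\mapsto D^2f(x)(\xi_1,\xi_2)$$ is continuous. -/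

import Mathlib

open Set Topology

universe u v

/-- A scale Banach space over `ℝ`: a nested sequence `E₀ ⊇ E₁ ⊇ E₂ ⊇ …` of real Banach spaces,
each with its own norm. The level `E_m` is the type `X m`, and for `m ≤ n` the inclusion of sets
`E_n ⊆ E_m` is the injective map `incl : X n → X m`; these inclusions compose as inclusions of
subsets do. Consecutive inclusions are compact, and the smooth points, i.e. the points of
`⋂ₙ E_n`, are dense in each level. -/
structure ScBanach where
  X : ℕ → Type u
  [normed : ∀ m, NormedAddCommGroup (X m)]
  [space : ∀ m, NormedSpace ℝ (X m)]
  [complete : ∀ m, CompleteSpace (X m)]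
  incl : ∀ {m n : ℕ}, m ≤ n → (X n →L[ℝ] X m)
  incl_self : ∀ (m : ℕ) (x : X m), incl (le_refl m) x = x
  incl_incl : ∀ {l m n : ℕ} (h : l ≤ m) (h' : m ≤ n) (x : X n),
    incl h (incl h' x) = incl (h.trans h') x
  injective : ∀ {m n : ℕ} (h : m ≤ n), Function.Injective (incl h)
  compact : ∀ m : ℕ, IsCompactOperator (incl (Nat.le_succ m))
  dense_smooth : ∀ m : ℕ, Dense {x : X m | ∀ (n : ℕ) (h : m ≤ n), x ∈ range (incl h)}

namespace ScBanach

attribute [instance] ScBanach.normed ScBanach.space ScBanach.complete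

/-- The inclusion `E_m → E_0` into the top level. -/
noncomputable def top (E : ScBanach.{u}) (m : ℕ) : E.X m →L[ℝ] E.X 0 := E.incl (Nat.zero_le m)

/-- The level `A_m = A ∩ E_m` of the scale induced by a subset `A` of the top level `E_0`. -/
def part (E : ScBanach.{u}) (A : Set (E.X 0)) (m : ℕ) : Set (E.X m) := {x | E.top m x ∈ A}

/-- The shifted scale `E^k`, with levels `(E^k)_m = E_{m+k}`. -/
@[reducible] noncomputable def shift (E : ScBanach.{u}) (k : ℕ) : ScBanach.{u} where
  X m := E.X (m + k)
  incl h := E.incl (Nat.add_le_add_right h k)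
  incl_self m x := E.incl_self (m + k) x
  incl_incl h h' x := E.incl_incl (Nat.add_le_add_right h k) (Nat.add_le_add_right h' k) x
  injective h := E.injective (Nat.add_le_add_right h k)
  compact m := by
    have h : m + k ≤ m + k + 1 := Nat.le_succ _
    have e : m + k + 1 = m + 1 + k := by omega
    have key : ∀ (j : ℕ) (hj : m + k ≤ j), m + k + 1 = j → IsCompactOperator (E.incl hj) := by
      rintro j hj rfl
      exact E.compact (m + k)
    exact key _ _ e
  dense_smooth m := by
    refine (E.dense_smooth (m + k)).mono ?_
    intro x hx n h
    exact hx (n + k) (Nat.add_le_add_right h k)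

/-- The direct sum `E ⊕ F`, with levels `(E ⊕ F)_m = E_m ⊕ F_m`. -/
@[reducible] noncomputable def prod (E : ScBanach.{u}) (F : ScBanach.{v}) : ScBanach.{max u v} where
  X m := E.X m × F.X m
  incl h := (E.incl h).prodMap (F.incl h)
  incl_self m x := Prod.ext (E.incl_self m x.1) (F.incl_self m x.2)
  incl_incl h h' x := Prod.ext (E.incl_incl h h' x.1) (F.incl_incl h h' x.2)
  injective h := (E.injective h).prodMap (F.injective h)
  compact m := by
    obtain ⟨K, hK, hK'⟩ := E.compact m
    obtain ⟨L, hL, hL'⟩ := F.compact m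
    refine ⟨K ×ˢ L, hK.prod hL, ?_⟩
    exact prod_mem_nhds (x := (0 : E.X (m + 1))) (y := (0 : F.X (m + 1))) hK' hL'
  dense_smooth m := by
    refine ((E.dense_smooth m).prod (F.dense_smooth m)).mono ?_
    rintro ⟨x, y⟩ ⟨hx, hy⟩ n h
    obtain ⟨x', hx'⟩ := hx n h
    obtain ⟨y', hy'⟩ := hy n h
    exact ⟨(x', y'), Prod.ext hx' hy'⟩

/-- A finite dimensional normed space with the constant scale structure. -/
@[reducible] noncomputable def const (W : Type u) [NormedAddCommGroup W] [NormedSpace ℝ W]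
    [FiniteDimensional ℝ W] : ScBanach.{u} where
  X _ := W
  complete _ := FiniteDimensional.complete ℝ W
  incl _ := ContinuousLinearMap.id ℝ W
  incl_self _ _ := rfl
  incl_incl _ _ _ := rfl
  injective _ := Function.injective_id
  compact _ := by
    have : ProperSpace W := FiniteDimensional.proper ℝ W
    exact ⟨Metric.closedBall 0 1, isCompact_closedBall 0 1,
      Metric.closedBall_mem_nhds (0 : W) one_pos⟩
  dense_smooth _ := by
    refine dense_univ.mono ?_
    intro x _ _ _
    exact ⟨x, rfl⟩

/-- The tangent bundle `TE = E^1 ⊕ E^0` of a scale Banach space; `(TE)_m = E_{m+1} ⊕ E_m`. -/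
@[reducible] noncomputable def tangent (E : ScBanach.{u}) : ScBanach.{u} := (E.shift 1).prod E

/-- The subset `TU = U^1 ⊕ E^0` of `TE`, given by its top level `U_1 × E_0`. -/
def tangentSet (E : ScBanach.{u}) (U : Set (E.X 0)) : Set (E.tangent.X 0) :=
  E.part U 1 ×ˢ (univ : Set (E.X 0))

end ScBanach

/-- A (linear) sc-isomorphism: a linear bijection `E_0 → F_0` which restricts at every level to a
continuous linear bijection `E_m → F_m` with continuous inverse. -/
structure ScIso (E : ScBanach.{u}) (F : ScBanach.{v}) where
  level : ∀ m : ℕ, E.X m ≃L[ℝ] F.X m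
  comm : ∀ {m n : ℕ} (h : m ≤ n) (x : E.X n), level m (E.incl h x) = F.incl h (level n x)

/-- `C ⊆ E` is a partial quadrant: some sc-isomorphism `E → ℝⁿ ⊕ W`, for some `n` and some
scale Banach space `W`, identifies `C` with `[0,∞)ⁿ ⊕ W`. -/
def IsPartialQuadrant (E : ScBanach.{u}) (C : Set (E.X 0)) : Prop :=
  ∃ (n : ℕ) (W : ScBanach.{u}) (T : ScIso E ((ScBanach.const (Fin n → ℝ)).prod W)),
    C = {x | ∀ i, 0 ≤ (T.level 0 x).1 i}

/-- `(U, C, E)` is an sc-triple: `C` is a partial quadrant in `E` and `U` is a relatively open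
subset of `C`. -/
structure IsScTriple (E : ScBanach.{u}) (C U : Set (E.X 0)) : Prop where
  quadrant : IsPartialQuadrant E C
  relOpen : ∃ O : Set (E.X 0), IsOpen O ∧ U = O ∩ C

section maps

variable {E : ScBanach.{u}} {F : ScBanach.{v}}

/-- `f : U → V` is of class sc⁰: at every level `m` it restricts to a continuous map
`U_m → V_m` (the map `g`, determined on `U_m` by `f`). Maps `U → V` are represented by functions
on the ambient space, whose values outside `U` are irrelevant. -/
def IsSc0 (U : Set (E.X 0)) (V : Set (F.X 0)) (f : E.X 0 → F.X 0) : Prop :=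
  MapsTo f U V ∧
    ∀ m : ℕ, ∃ g : E.X m → F.X m,
      (∀ x ∈ E.part U m, F.top m (g x) = f (E.top m x)) ∧ ContinuousOn g (E.part U m)

/-- The map `f : U_k → F_0`, the top diagonal map of height `k`. -/
noncomputable def topDiag (f : E.X 0 → F.X 0) (k : ℕ) : E.X k → F.X 0 := fun x => f (E.top k x)

/-- `D` is the sc-derivative of `f` on `U`: at every `x ∈ U_1` the map `f : U_1 → F_0` is
Fréchet differentiable (with increments `h` such that `x + h ∈ U_1`), and the bounded operator
`D x : E_0 → F_0` extends its derivative `df(x) : E_1 → F_0`. -/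
def IsScDeriv (U : Set (E.X 0)) (f : E.X 0 → F.X 0) (D : E.X 1 → (E.X 0 →L[ℝ] F.X 0)) : Prop :=
  ∀ x ∈ E.part U 1, HasFDerivWithinAt (topDiag f 1) ((D x).comp (E.top 1)) (E.part U 1) x

/-- `g` is the tangent map `Tf : TU → TF`, `Tf(x, ξ) = (f(x), Df(x)ξ)`, where `Df` is the
sc-derivative of `f`. As `E_1` is dense in `E_0`, there is at most one sc-derivative on `U_1`, so
that `g` is determined by `f` on `TU`. -/
def IsTangentMap (U : Set (E.X 0)) (f : E.X 0 → F.X 0)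
    (g : E.tangent.X 0 → F.tangent.X 0) : Prop :=
  ∃ D : E.X 1 → (E.X 0 →L[ℝ] F.X 0), IsScDeriv U f D ∧
    ∀ (x : E.X 1) (ξ : E.X 0), x ∈ E.part U 1 →
      F.top 1 (g (x, ξ)).1 = f (E.top 1 x) ∧ (g (x, ξ)).2 = D x ξ

/-- `f : U → V` is of class sc¹: it is sc⁰, its sc-derivative exists, and the tangent map
`Tf : TU → TV` is sc⁰. -/
def IsSc1 (U : Set (E.X 0)) (V : Set (F.X 0)) (f : E.X 0 → F.X 0) : Prop :=
  IsSc0 U V f ∧ ∃ Tf : E.tangent.X 0 → F.tangent.X 0, IsTangentMap U f Tf ∧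
    IsSc0 (E := E.tangent) (F := F.tangent) (E.tangentSet U) (F.tangentSet V) Tf

/-- `f : U → V` is of class sc²: it is sc¹ and its tangent map `Tf : TU → TV` is sc¹. -/
def IsSc2 (U : Set (E.X 0)) (V : Set (F.X 0)) (f : E.X 0 → F.X 0) : Prop :=
  IsSc1 U V f ∧ ∃ Tf : E.tangent.X 0 → F.tangent.X 0, IsTangentMap U f Tf ∧
    IsSc1 (E := E.tangent) (F := F.tangent) (E.tangentSet U) (F.tangentSet V) Tf

/-- The usual Fréchet differential `df : U_2 → L(E_2, F_0)` of `f : U_2 → F_0`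
(`U_2` is a relatively open subset of a convex set with nonempty interior, so that derivatives
within `U_2` are unique). -/
noncomputable def diff2 (U : Set (E.X 0)) (f : E.X 0 → F.X 0) : E.X 2 → (E.X 2 →L[ℝ] F.X 0) :=
  fderivWithin ℝ (topDiag f 2) (E.part U 2)

/-- `f : U_2 → F_0` is pointwise twice Fréchet differentiable. -/
def TwiceDiff (U : Set (E.X 0)) (f : E.X 0 → F.X 0) : Prop :=
  DifferentiableOn ℝ (topDiag f 2) (E.part U 2) ∧ DifferentiableOn ℝ (diff2 U f) (E.part U 2)

/-- The second derivative `d²f(x)`, a continuous bilinear map `E_2 ⊕ E_2 → F_0`. -/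
noncomputable def secondDeriv (U : Set (E.X 0)) (f : E.X 0 → F.X 0) (x : E.X 2) :
    E.X 2 →L[ℝ] E.X 2 →L[ℝ] F.X 0 :=
  fderivWithin ℝ (diff2 U f) (E.part U 2) x

/-- `H` is the sc-Hessian `D²f` of `f`: at every `x ∈ U_2` the continuous bilinear map
`H x : E_1 ⊕ E_1 → F_0` extends `d²f(x) : E_2 ⊕ E_2 → F_0`. -/
def IsScHessian (U : Set (E.X 0)) (f : E.X 0 → F.X 0)
    (H : E.X 2 → (E.X 1 →L[ℝ] E.X 1 →L[ℝ] F.X 0)) : Prop :=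
  ∀ x ∈ E.part U 2, ∀ ξ η : E.X 2,
    H x (E.incl one_le_two ξ) (E.incl one_le_two η) = secondDeriv U f x ξ η

/-- For all `m` and `x ∈ U_{m+2}`, the map `H x` restricts to a continuous bilinear map
`B x : E_{m+1} ⊕ E_{m+1} → F_m`, and `(x, ξ, η) ↦ B x ξ η` is continuous as a map
`U_{m+2} ⊕ E_{m+1} ⊕ E_{m+1} → F_m`. -/
def HessianRestricts (U : Set (E.X 0))
    (H : E.X 2 → (E.X 1 →L[ℝ] E.X 1 →L[ℝ] F.X 0)) : Prop :=
  ∀ m : ℕ, ∃ B : E.X (m + 2) → (E.X (m + 1) →L[ℝ] E.X (m + 1) →L[ℝ] F.X m),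
    (∀ x ∈ E.part U (m + 2), ∀ ξ η : E.X (m + 1),
      F.top m (B x ξ η) =
        H (E.incl (Nat.le_add_left 2 m) x)
          (E.incl (Nat.le_add_left 1 m) ξ) (E.incl (Nat.le_add_left 1 m) η)) ∧
    ContinuousOn (fun p : E.X (m + 2) × E.X (m + 1) × E.X (m + 1) => B p.1 p.2.1 p.2.2)
      (E.part U (m + 2) ×ˢ univ)

end maps

/-!
The derivative of the tangent map `Tf(x, η) = (f(x), Df(x)η)` has to be
`(h, k) ↦ (Df(x)h, D²f(x)(h, η) + Df(x)k)`, so that class sc² amounts to the existence of `D²f`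
with the stated continuity on levels, once two kinds of differentiability are matched: that of
`(x, η) ↦ Df(x)η` on `U_2 ⊕ E_1`, and that of `df : U_2 → L(E_2, F_0)` in the operator norm.

The compactness of `E_2 → E_1` bridges the gap. The scale conditions only give strong continuity
(joint continuity of the evaluation), but a strongly continuous family of operators becomes
continuous in the operator norm after precomposition with a compact operator
(`continuousOn_comp_of_isCompactOperator`). Together with the fundamental theorem of calculus along
segments, available because partial quadrants are convex, this turns weak information about
derivatives into Fréchet differentiability:

* `hasFDerivWithinAt_of_separating`: a map whose compositions with a separating family of operators
  have the derivatives predicted by a norm continuous `G` has derivative `G`. Applied to evaluations,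
  it shows that `df` is differentiable if `Tf` is of class sc¹; applied to the inclusion `F_1 → F_0`,
  that `f : U_2 → F_1` is differentiable if `f` is of class sc¹.
* `hasFDerivWithinAt_apply_of_dense`: if `x ↦ Df(x)η` has derivative `D²f(x)(·, η)` for `η` in the
  dense subspace `E_2` of `E_1`, then `(x, η) ↦ Df(x)η` is differentiable on `U_2 ⊕ E_1`.

In the direct implication, `D²f(x)(ξ, η)` is defined as the second component of `D(Tf)(x, η)(ξ, 0)`.
It is linear in `η` because `Df(x)η` is: derivatives within `U_2` are unique, and determine a
bounded operator on `E_1`, as `E_2` is dense there.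
-/

/-! ### Strong continuity, compact operators and differentiability -/

section analysis

variable {X Y Z : Type*} [NormedAddCommGroup X] [NormedSpace ℝ X] [NormedAddCommGroup Y]
  [NormedSpace ℝ Y] [NormedAddCommGroup Z] [NormedSpace ℝ Z]

/-- A strongly continuous family of operators becomes continuous in the operator norm after
precomposition with a compact operator: the convergence is uniform on the relatively compact image
of the unit ball. -/
theorem continuousOn_comp_of_isCompactOperator {P : Type*} [TopologicalSpace P] {K : X →L[ℝ] Y}
    (hK : IsCompactOperator K) {s : Set P} {Φ : P → Y →L[ℝ] Z}
    (hΦ : ContinuousOn (fun q : P × Y => Φ q.1 q.2) (s ×ˢ univ)) :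
    ContinuousOn (fun p => (Φ p).comp K) s := by
  intro p₀ hp₀
  rw [ContinuousWithinAt, Metric.tendsto_nhds]
  intro ε hε
  have hQ : IsCompact (closure (K '' Metric.closedBall 0 1)) :=
    hK.isCompact_closure_image_closedBall 1
  have key : ∀ᶠ p in 𝓝 p₀, ∀ y ∈ closure (K '' Metric.closedBall 0 1),
      p ∈ s → dist (Φ p y) (Φ p₀ y) < ε / 2 := by
    refine hQ.eventually_forall_of_forall_eventually (P := fun p y =>
      p ∈ s → dist (Φ p y) (Φ p₀ y) < ε / 2) fun y _ => ?_
    have h1 := hΦ (p₀, y) ⟨hp₀, mem_univ _⟩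
    have h2 : ContinuousAt (fun q : P × Y => Φ p₀ q.2) (p₀, y) := by fun_prop
    have h3 := h1.dist h2.continuousWithinAt
    have h4 := h3.eventually_lt (continuousWithinAt_const (b := ε / 2)) (by simpa using hε)
    filter_upwards [eventually_nhdsWithin_iff.1 h4] with q hq hs
    exact hq ⟨hs, mem_univ _⟩
  filter_upwards [eventually_nhdsWithin_iff.2 (key.mono fun p hp hs y hy => hp y hy hs)]
    with p hp
  rw [dist_eq_norm]
  refine lt_of_le_of_lt (ContinuousLinearMap.opNorm_le_of_unit_norm (half_pos hε).le ?_)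
    (half_lt_self hε)
  intro x hx
  have := hp (K x) (subset_closure ⟨x, by simp [hx], rfl⟩)
  simpa [dist_eq_norm] using this.le

/-- A map into a Banach space is differentiable as soon as it is so after composition with a
separating family of operators, provided that the derivatives come from a norm continuous `G`: the
increment `f y - f x` is then the integral of `G` along the segment from `x` to `y`. -/
theorem hasFDerivWithinAt_of_separating [CompleteSpace Y] [CompleteSpace Z] {ι : Type*}
    {O C : Set X} (hO : IsOpen O) (hC : Convex ℝ C) {f : X → Y} {G : X → X →L[ℝ] Y}
    (hG : ContinuousOn G (O ∩ C)) (l : ι → Y →L[ℝ] Z) (hl : ∀ y, (∀ i, l i y = 0) → y = 0)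
    (hd : ∀ i, ∀ x ∈ O ∩ C,
      HasFDerivWithinAt (fun y => l i (f y)) ((l i).comp (G x)) (O ∩ C) x)
    {x : X} (hx : x ∈ O ∩ C) : HasFDerivWithinAt f (G x) (O ∩ C) x := by
  rw [hasFDerivWithinAt_iff_isLittleO, Asymptotics.isLittleO_iff]
  intro ε hε
  obtain ⟨r₁, hr₁, hball⟩ := Metric.isOpen_iff.1 hO x hx.1
  obtain ⟨r₂, hr₂, hGr⟩ := Metric.continuousWithinAt_iff.1 (hG x hx) ε hε
  filter_upwards [self_mem_nhdsWithin, nhdsWithin_le_nhds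
    (Metric.ball_mem_nhds x (lt_min hr₁ hr₂))] with y hy hyr
  set γ : ℝ → X := fun t => x + t • (y - x) with hγ
  have hγmem : ∀ t ∈ Icc (0 : ℝ) 1, γ t ∈ O ∩ C ∧ ‖G (γ t) - G x‖ ≤ ε := by
    intro t ht
    have hb : γ t ∈ Metric.ball x (min r₁ r₂) :=
      (convex_ball x _).add_smul_sub_mem (Metric.mem_ball_self (lt_min hr₁ hr₂)) hyr ht
    have hm : γ t ∈ O ∩ C :=
      ⟨hball (Metric.ball_subset_ball (min_le_left _ _) hb),
        hC.add_smul_sub_mem hx.2 hy.2 ht⟩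
    refine ⟨hm, ?_⟩
    rw [← dist_eq_norm]
    exact (hGr hm (Metric.ball_subset_ball (min_le_right _ _) hb)).le
  have hγd : ∀ t, HasDerivAt γ (y - x) t := fun t => by
    simpa [hγ] using ((hasDerivAt_id' t).smul_const (y - x)).const_add x
  have hγc : Continuous γ := by fun_prop
  have hmaps : MapsTo γ (Icc 0 1) (O ∩ C) := fun t ht => (hγmem t ht).1
  have hcont : ContinuousOn (fun t => G (γ t) (y - x)) (Icc 0 1) :=
    (hG.comp hγc.continuousOn hmaps).clm_apply continuousOn_const
  have hint : IntervalIntegrable (fun t => G (γ t) (y - x)) MeasureTheory.volume 0 1 :=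
    ContinuousOn.intervalIntegrable (by rwa [uIcc_of_le zero_le_one])
  have hv : f y - f x = ∫ t in (0 : ℝ)..1, G (γ t) (y - x) := by
    rw [← sub_eq_zero]
    refine hl _ fun i => ?_
    have hder : ∀ t ∈ Icc (0 : ℝ) 1, HasDerivWithinAt (fun t => l i (f (γ t)))
        (l i (G (γ t) (y - x))) (Icc 0 1) t := fun t ht =>
      (hd i (γ t) (hmaps ht)).comp_hasDerivWithinAt t (hγd t).hasDerivWithinAt hmaps
    have hftc := intervalIntegral.integral_eq_sub_of_hasDerivAt_of_le zero_le_one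
      (fun t ht => (hder t ht).continuousWithinAt)
      (fun t ht => (hder t (Ioo_subset_Icc_self ht)).hasDerivAt (Icc_mem_nhds ht.1 ht.2))
      (ContinuousOn.intervalIntegrable (by
        rw [uIcc_of_le zero_le_one]; exact (l i).continuous.comp_continuousOn hcont))
    rw [map_sub, ← ContinuousLinearMap.intervalIntegral_comp_comm _ hint, hftc]
    simp [hγ]
  have hfin : f y - f x - G x (y - x) = ∫ t in (0 : ℝ)..1, (G (γ t) - G x) (y - x) := by
    simp only [sub_apply]
    rw [intervalIntegral.integral_sub hint (by simp), hv]
    simp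
  rw [hfin]
  have := intervalIntegral.norm_integral_le_of_norm_le_const (a := (0 : ℝ)) (b := 1)
    (f := fun t => (G (γ t) - G x) (y - x)) (C := ε * ‖y - x‖) (by
      intro t ht
      rw [uIoc_of_le zero_le_one] at ht
      exact ContinuousLinearMap.le_of_opNorm_le _ (hγmem t (Ioc_subset_Icc_self ht)).2 _)
  simpa using this

/-- If, for `η` in a dense set `S`, the map `x ↦ A x η` has derivative `h ↦ B x (K h) η` with `K`
compact and `B` strongly continuous, then `(x, η) ↦ A x η` is differentiable at every point. -/
theorem hasFDerivWithinAt_apply_of_dense {W : Type*} [NormedAddCommGroup W] [NormedSpace ℝ W]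
    {O C : Set X} (hO : IsOpen O) (hC : Convex ℝ C)
    {A : X → Y →L[ℝ] Z} {B : X → W →L[ℝ] Y →L[ℝ] Z} {K : X →L[ℝ] W} (hK : IsCompactOperator K)
    (hB : ContinuousOn (fun q : X × W × Y => B q.1 q.2.1 q.2.2) ((O ∩ C) ×ˢ univ))
    {S : Set Y} (hS : Dense S)
    (hd : ∀ η ∈ S, ∀ x ∈ O ∩ C,
      HasFDerivWithinAt (fun y => A y η) (((B x).flip η).comp K) (O ∩ C) x)
    {x : X} (hx : x ∈ O ∩ C) (η : Y) :
    HasFDerivWithinAt (fun p : X × Y => A p.1 p.2)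
      ((((B x).flip η).comp K).coprod (A x)) ((O ∩ C) ×ˢ univ) (x, η) := by
  have hBc : ContinuousOn (fun p : X × Y => ((B p.1).flip p.2).comp K)
      ((O ∩ C) ×ˢ (univ : Set Y)) := by
    refine continuousOn_comp_of_isCompactOperator hK (Φ := fun p : X × Y => (B p.1).flip p.2) ?_
    exact hB.comp (f := fun q : (X × Y) × W => (q.1.1, q.2, q.1.2)) (by fun_prop)
      fun q hq => ⟨hq.1.1, mem_univ _⟩
  rw [hasFDerivWithinAt_iff_isLittleO, Asymptotics.isLittleO_iff]
  intro ε hε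
  obtain ⟨r₁, hr₁, hball⟩ := Metric.isOpen_iff.1 hO x hx.1
  obtain ⟨r₂, hr₂, hBr⟩ := Metric.continuousWithinAt_iff.1 (hBc (x, η) ⟨hx, mem_univ _⟩) ε hε
  filter_upwards [self_mem_nhdsWithin, nhdsWithin_le_nhds
    (Metric.ball_mem_nhds (x, η) (lt_min hr₁ hr₂))] with p hp hpr
  obtain ⟨y, ζ⟩ := p
  rw [← ball_prod_same] at hpr
  obtain ⟨hyr, hζr⟩ := hpr
  simp only at hyr hζr
  set T : X →L[ℝ] Z := ((B x).flip η).comp K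
  have hconv : Convex ℝ (Metric.ball x (min r₁ r₂) ∩ C) := (convex_ball _ _).inter hC
  have hsub : Metric.ball x (min r₁ r₂) ∩ C ⊆ O ∩ C := fun z hz =>
    ⟨hball (Metric.ball_subset_ball (min_le_left _ _) hz.1), hz.2⟩
  have hS' : ∀ ξ ∈ Metric.ball η (min r₁ r₂) ∩ S, ‖A y ξ - A x ξ - T (y - x)‖ ≤ ε * ‖y - x‖ := by
    intro ξ hξ
    refine hconv.norm_image_sub_le_of_norm_hasFDerivWithin_le'
      (fun z hz => (hd ξ hξ.2 z (hsub hz)).mono hsub) (fun z hz => ?_)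
      ⟨Metric.mem_ball_self (lt_min hr₁ hr₂), hx.2⟩ ⟨hyr, hp.1.2⟩
    have := hBr (x := (z, ξ)) ⟨hsub hz, mem_univ _⟩ (by
      rw [Prod.dist_eq]
      exact max_lt (lt_of_lt_of_le hz.1 (min_le_right _ _))
        (lt_of_lt_of_le hξ.1 (min_le_right _ _)))
    rw [← dist_eq_norm]
    exact this.le
  -- The estimate has a bound independent of `ξ`, so it passes from `S` to nearby points of `Y`.
  have hcl : IsClosed {ξ | ‖A y ξ - A x ξ - T (y - x)‖ ≤ ε * ‖y - x‖} :=
    isClosed_le (by fun_prop) continuous_const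
  have hζ : ‖A y ζ - A x ζ - T (y - x)‖ ≤ ε * ‖y - x‖ :=
    closure_minimal (fun ξ hξ => hS' ξ hξ) hcl
      (hS.open_subset_closure_inter Metric.isOpen_ball hζr)
  -- Since `A x` is linear, the remainder at `(y, ζ)` is the one just estimated.
  have hrw : A y ζ - A x η - (T.coprod (A x)) ((y, ζ) - (x, η)) =
      A y ζ - A x ζ - T (y - x) := by
    simp only [Prod.mk_sub_mk, ContinuousLinearMap.coprod_apply, map_sub]
    abel
  rw [hrw]
  refine hζ.trans (mul_le_mul_of_nonneg_left ?_ hε.le)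
  exact norm_fst_le ((y, ζ) - (x, η))

theorem exists_continuousLinearMap_of_continuous {b : X → Y}
    (hadd : ∀ ξ ξ', b (ξ + ξ') = b ξ + b ξ') (hsmul : ∀ (c : ℝ) ξ, b (c • ξ) = c • b ξ)
    (hb : Continuous b) : ∃ B : X →L[ℝ] Y, ∀ ξ, B ξ = b ξ :=
  ⟨{ toFun := b, map_add' := hadd, map_smul' := hsmul, cont := hb }, fun _ => rfl⟩

theorem exists_continuousLinearMap₂_of_continuous {b : X → Y → Z}
    (hadd₁ : ∀ ξ ξ' η, b (ξ + ξ') η = b ξ η + b ξ' η)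
    (hsmul₁ : ∀ (c : ℝ) ξ η, b (c • ξ) η = c • b ξ η)
    (hadd₂ : ∀ ξ η η', b ξ (η + η') = b ξ η + b ξ η')
    (hsmul₂ : ∀ (c : ℝ) ξ η, b ξ (c • η) = c • b ξ η)
    (hb : Continuous fun p : X × Y => b p.1 p.2) :
    ∃ B : X →L[ℝ] Y →L[ℝ] Z, ∀ ξ η, B ξ η = b ξ η := by
  have h0 : ∀ η, b 0 η = 0 := fun η => by simpa using hsmul₁ 0 0 η
  have h0' : ∀ ξ, b ξ 0 = 0 := fun η => by simpa using hsmul₂ 0 η 0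
  obtain ⟨δ, hδ, hbound⟩ := Metric.continuousAt_iff.1 (hb.continuousAt (x := (0, 0))) 1 one_pos
  set c : ℝ := δ / 2 with hc
  have hcpos : 0 < c := half_pos hδ
  have hball : ∀ ξ η, ‖ξ‖ ≤ c → ‖η‖ ≤ c → ‖b ξ η‖ ≤ 1 := by
    intro ξ η hξ hη
    have := hbound (x := (ξ, η)) (by
      rw [Prod.dist_eq]
      simp only [dist_zero_right]
      exact max_lt (by linarith) (by linarith))
    simpa [h0] using this.le
  refine ⟨LinearMap.mkContinuous₂ (LinearMap.mk₂ ℝ b hadd₁ hsmul₁ hadd₂ hsmul₂)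
    (c⁻¹ * c⁻¹) fun ξ η => ?_, fun ξ η => rfl⟩
  rw [LinearMap.mk₂_apply]
  rcases eq_or_ne ξ 0 with rfl | hξ
  · simp [h0]
  rcases eq_or_ne η 0 with rfl | hη
  · simp [h0']
  have hξ' : 0 < ‖ξ‖ := norm_pos_iff.2 hξ
  have hη' : 0 < ‖η‖ := norm_pos_iff.2 hη
  have := hball ((c / ‖ξ‖) • ξ) ((c / ‖η‖) • η)
    (by rw [norm_smul, Real.norm_of_nonneg (by positivity)]; field_simp; rfl)
    (by rw [norm_smul, Real.norm_of_nonneg (by positivity)]; field_simp; rfl)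
  rw [hsmul₁, hsmul₂, smul_smul, norm_smul, Real.norm_of_nonneg (by positivity)] at this
  have h2 : ‖b ξ η‖ = (c⁻¹ * c⁻¹ * ‖ξ‖ * ‖η‖) * (c / ‖ξ‖ * (c / ‖η‖) * ‖b ξ η‖) := by
    field_simp
  rw [h2]
  exact mul_le_of_le_one_right (by positivity) this

end analysis

/-! ### Levels of a scale and of its tangent bundle -/

section scales

variable {E : ScBanach.{u}} {F : ScBanach.{v}}

namespace ScBanach

theorem top_injective (m : ℕ) : Function.Injective (E.top m) := E.injective _

theorem top_zero (x : E.X 0) : E.top 0 x = x := E.incl_self 0 x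

theorem top_incl {m n : ℕ} (h : m ≤ n) (x : E.X n) : E.top m (E.incl h x) = E.top n x :=
  E.incl_incl _ _ x

theorem incl_mem_part {U : Set (E.X 0)} {m n : ℕ} (h : m ≤ n) {x : E.X n} :
    E.incl h x ∈ E.part U m ↔ x ∈ E.part U n := by
  simp only [part, mem_ofPred_eq, top_incl]

theorem denseRange_incl {m n : ℕ} (h : m ≤ n) : DenseRange (E.incl h) := by
  refine (E.dense_smooth m).mono ?_
  intro x hx
  exact hx n h

theorem mem_part_tangentSet {U : Set (E.X 0)} {m : ℕ} {p : E.X (m + 1) × E.X m} :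
    p ∈ E.tangent.part (E.tangentSet U) m ↔ p.1 ∈ E.part U (m + 1) := by
  have h : E.tangent.top m p = (E.incl (Nat.le_add_left 1 m) p.1, E.top m p.2) := rfl
  simp only [part, tangentSet, mem_ofPred_eq, h, mem_prod, mem_univ, and_true]
  exact incl_mem_part (Nat.le_add_left 1 m)

theorem part_tangentSet (U : Set (E.X 0)) (m : ℕ) :
    E.tangent.part (E.tangentSet U) m = E.part U (m + 1) ×ˢ (univ : Set (E.X m)) := by
  ext p
  exact mem_part_tangentSet.trans (by simp)

theorem part_tangentSet_tangentSet (U : Set (E.X 0)) (m : ℕ) :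
    E.tangent.tangent.part (E.tangent.tangentSet (E.tangentSet U)) m =
      (E.part U (m + 2) ×ˢ (univ : Set (E.X (m + 1)))) ×ˢ (univ : Set (E.X (m + 1) × E.X m)) := by
  rw [part_tangentSet, part_tangentSet]

end ScBanach

/-- Each level `U_m` is the intersection of an open set with a convex set with interior points. -/
theorem IsScTriple.exists_part_eq {C U : Set (E.X 0)} (hU : IsScTriple E C U) (m : ℕ) :
    ∃ O C' : Set (E.X m), IsOpen O ∧ Convex ℝ C' ∧ (interior C').Nonempty ∧
      E.part U m = O ∩ C' := by
  obtain ⟨⟨n, W, T, rfl⟩, O, hO, rfl⟩ := hU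
  set t : E.X m →L[ℝ] (Fin n → ℝ) :=
    (ContinuousLinearMap.fst ℝ (Fin n → ℝ) (W.X m)).comp (T.level m : E.X m →L[ℝ] _) with ht
  have htop : ∀ x : E.X m, (T.level 0 (E.top m x)).1 = t x := fun x =>
    congrArg Prod.fst (T.comm (Nat.zero_le m) x)
  refine ⟨E.top m ⁻¹' O, {x | ∀ i, 0 ≤ t x i}, hO.preimage (E.top m).continuous, ?_, ?_, ?_⟩
  · simp only [ofPred_forall]
    exact convex_iInter fun i => (convex_Ici (0 : ℝ)).linear_preimage
      ((LinearMap.proj i).comp (t : E.X m →ₗ[ℝ] (Fin n → ℝ)))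
  · refine ⟨(T.level m).symm (fun _ => 1, 0), mem_interior.2
      ⟨{x | ∀ i, 0 < t x i}, fun x hx i => (hx i).le, ?_, fun i => ?_⟩⟩
    · simp only [ofPred_forall]
      exact isOpen_iInter_of_finite fun i => isOpen_lt continuous_const (by fun_prop)
    · simp [ht]
  · ext x
    simp only [ScBanach.part, mem_ofPred_eq, mem_inter_iff, mem_preimage, htop]

theorem IsScTriple.uniqueDiffOn {C U : Set (E.X 0)} (hU : IsScTriple E C U) (m : ℕ) :
    UniqueDiffOn ℝ (E.part U m) := by
  obtain ⟨O, C', hO, hC, hi, h⟩ := hU.exists_part_eq m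
  rw [h, inter_comm]
  exact (uniqueDiffOn_convex hC hi).inter hO

theorem IsScDeriv.hasFDerivWithinAt_topDiag_two {U : Set (E.X 0)} {f : E.X 0 → F.X 0}
    {D : E.X 1 → (E.X 0 →L[ℝ] F.X 0)} (hD : IsScDeriv U f D) {x : E.X 2} (hx : x ∈ E.part U 2) :
    HasFDerivWithinAt (topDiag f 2) ((D (E.incl one_le_two x)).comp (E.top 2)) (E.part U 2) x := by
  have h := (hD (E.incl one_le_two x) ((E.incl_mem_part one_le_two).2 hx)).comp x
    (E.incl one_le_two).hasFDerivWithinAt (fun y hy => (E.incl_mem_part one_le_two).2 hy)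
  convert h using 1
  · ext y
    simp [topDiag, E.top_incl]
  · ext y
    simp [E.top_incl]

theorem IsScDeriv.diff2_eq {C U : Set (E.X 0)} (hU : IsScTriple E C U) {f : E.X 0 → F.X 0}
    {D : E.X 1 → (E.X 0 →L[ℝ] F.X 0)} (hD : IsScDeriv U f D) {x : E.X 2} (hx : x ∈ E.part U 2) :
    diff2 U f x = (D (E.incl one_le_two x)).comp (E.top 2) :=
  (hD.hasFDerivWithinAt_topDiag_two hx).fderivWithin (hU.uniqueDiffOn 2 x hx)

/-- If the tangent map of `f` restricts continuously to level one, `f` is differentiable as a map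
`U_2 → F_1`, and not only as a map into `F_0`. Here `f₁` is `f : U_2 → F_1`, and `D₁ x` is the
restriction of `D x` to an operator `E_1 → F_1`. -/
theorem IsScDeriv.hasFDerivWithinAt_lift {C U : Set (E.X 0)} (hU : IsScTriple E C U)
    {f : E.X 0 → F.X 0} {D : E.X 1 → (E.X 0 →L[ℝ] F.X 0)} (hD : IsScDeriv U f D)
    {f₁ : E.X 2 → F.X 1} (hf₁ : ∀ x ∈ E.part U 2, F.top 1 (f₁ x) = f (E.top 2 x))
    {D₁ : E.X 2 → (E.X 1 →L[ℝ] F.X 1)}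
    (hD₁ : ∀ x ∈ E.part U 2, ∀ ξ, F.top 1 (D₁ x ξ) = D (E.incl one_le_two x) (E.top 1 ξ))
    (hc : ContinuousOn (fun q : E.X 2 × E.X 1 => D₁ q.1 q.2) (E.part U 2 ×ˢ univ))
    {x : E.X 2} (hx : x ∈ E.part U 2) :
    HasFDerivWithinAt f₁ ((D₁ x).comp (E.incl one_le_two)) (E.part U 2) x := by
  have hG := continuousOn_comp_of_isCompactOperator (E.compact 1) hc
  obtain ⟨O, C', hO, hC, -, h⟩ := hU.exists_part_eq 2
  have hd : ∀ y ∈ E.part U 2, HasFDerivWithinAt (fun y => F.top 1 (f₁ y))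
      ((F.top 1).comp ((D₁ y).comp (E.incl one_le_two))) (E.part U 2) y := fun y hy => by
    have h1 := (hD.hasFDerivWithinAt_topDiag_two hy).congr (fun z hz => hf₁ z hz) (hf₁ y hy)
    convert h1 using 1
    ext ξ
    simp [hD₁ y hy, E.top_incl]
  rw [h] at hG hd hx ⊢
  exact hasFDerivWithinAt_of_separating hO hC (ι := Unit) hG (fun _ => F.top 1)
    (fun y hy => F.top_injective 1 (by simpa using hy ())) (fun _ => hd) hx

end scales

/-! ### From the sc-Hessian to the tangent map -/

section maps

variable {E : ScBanach.{u}} {F : ScBanach.{v}}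

/-- On level `m`, an sc⁰ tangent map restricts to `(x, ξ) ↦ (b x, L x ξ)` for a continuous map `b`,
the restriction of `f`, and a strongly continuous family `L` of bounded operators. -/
theorem exists_tangentMap_lift {U : Set (E.X 0)} {V : Set (F.X 0)}
    {D : E.X 1 → (E.X 0 →L[ℝ] F.X 0)}
    {Tf : E.tangent.X 0 → F.tangent.X 0}
    {f : E.X 0 → F.X 0} (hTf : ∀ (x : E.X 1) (ξ : E.X 0), x ∈ E.part U 1 →
      F.top 1 (Tf (x, ξ)).1 = f (E.top 1 x) ∧ (Tf (x, ξ)).2 = D x ξ)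
    (h0 : IsSc0 (E := E.tangent) (F := F.tangent) (E.tangentSet U) (F.tangentSet V) Tf) (m : ℕ) :
    ∃ (b : E.X (m + 1) → F.X (m + 1)) (L : E.X (m + 1) → (E.X m →L[ℝ] F.X m)),
      (∀ x ∈ E.part U (m + 1), ∀ ξ, F.tangent.top m (b x, L x ξ) = Tf (E.tangent.top m (x, ξ))) ∧
      ContinuousOn b (E.part U (m + 1)) ∧
      ContinuousOn (fun q : E.X (m + 1) × E.X m => L q.1 q.2) (E.part U (m + 1) ×ˢ univ) := by
  obtain ⟨g, hg, hgc⟩ := h0.2 m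
  rw [ScBanach.part_tangentSet] at hg hgc
  have hg' : ∀ x ∈ E.part U (m + 1), ∀ ξ, F.tangent.top m (g (x, ξ)) =
      Tf (E.tangent.top m (x, ξ)) := fun x hx ξ => hg _ ⟨hx, mem_univ _⟩
  have hsnd : ∀ x ∈ E.part U (m + 1), ∀ ξ,
      F.top m (g (x, ξ)).2 = D (E.incl (Nat.le_add_left 1 m) x) (E.top m ξ) := fun x hx ξ =>
    (congrArg Prod.snd (hg' x hx ξ)).trans
      (hTf _ _ ((E.incl_mem_part (Nat.le_add_left 1 m)).2 hx)).2
  have hfst : ∀ x ∈ E.part U (m + 1), ∀ ξ, (g (x, ξ)).1 = (g (x, 0)).1 := fun x hx ξ => by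
    have hx' := (E.incl_mem_part (Nat.le_add_left 1 m)).2 hx
    have key : ∀ ζ, F.top (m + 1) (g (x, ζ)).1 = f (E.top 1 (E.incl (Nat.le_add_left 1 m) x)) :=
      fun ζ => (F.top_incl (Nat.le_add_left 1 m) (g (x, ζ)).1).symm.trans
        ((congrArg (fun p => F.top 1 p.1) (hg' x hx ζ)).trans (hTf _ (E.top m ζ) hx').1)
    exact F.top_injective (m + 1) ((key ξ).trans (key 0).symm)
  have hpair : ∀ x ∈ E.part U (m + 1), Continuous fun ξ : E.X m => (g (x, ξ)).2 := by
    intro x hx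
    have h1 : ContinuousOn (fun ξ : E.X m => (g (x, ξ)).2) univ :=
      (continuous_snd.comp_continuousOn hgc).comp (f := fun ξ : E.X m => (x, ξ)) (by fun_prop)
        fun ξ _ => ⟨hx, mem_univ _⟩
    exact continuousOn_univ.1 h1
  have hex : ∀ x : E.X (m + 1), ∃ L : E.X m →L[ℝ] F.X m, x ∈ E.part U (m + 1) →
      ∀ ξ, L ξ = (g (x, ξ)).2 := by
    intro x
    by_cases hx : x ∈ E.part U (m + 1)
    · obtain ⟨L, hL⟩ := exists_continuousLinearMap_of_continuous
        (fun ξ ξ' => F.top_injective m (by rw [map_add]; simp only [hsnd x hx, map_add]))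
        (fun c ξ => F.top_injective m (by rw [map_smul]; simp only [hsnd x hx, map_smul]))
        (hpair x hx)
      exact ⟨L, fun _ => hL⟩
    · exact ⟨0, fun h => absurd h hx⟩
  choose L hL using hex
  refine ⟨fun x => (g (x, 0)).1, L, fun x hx ξ => ?_, ?_, ?_⟩
  · rw [hL x hx]
    exact (congrArg (fun y => F.tangent.top m (y, (g (x, ξ)).2)) (hfst x hx ξ).symm).trans
      (hg' x hx ξ)
  · exact (continuous_fst.comp_continuousOn hgc).comp (f := fun x : E.X (m + 1) => (x, (0 : E.X m)))
      (by fun_prop) fun x hx => ⟨hx, mem_univ _⟩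
  · exact (continuous_snd.comp_continuousOn hgc).congr fun q hq => hL q.1 hq.1 q.2

theorem IsSc1.isSc2_of_hessian {C U : Set (E.X 0)} {V : Set (F.X 0)}
    (hU : IsScTriple E C U) {f : E.X 0 → F.X 0} (hf : IsSc1 U V f) (h2 : TwiceDiff U f)
    {H : E.X 2 → (E.X 1 →L[ℝ] E.X 1 →L[ℝ] F.X 0)} (hH : IsScHessian U f H)
    (hR : HessianRestricts U H) : IsSc2 U V f := by
  obtain ⟨-, Tf, ⟨D, hD, hTf⟩, hT0⟩ := id hf
  choose b L hbL hb hL using exists_tangentMap_lift hTf hT0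
  choose B hBH hB using hR
  have hL0 : ∀ (m : ℕ), ∀ x ∈ E.part U (m + 1), ∀ ξ, F.top m (L m x ξ) =
      D (E.incl (Nat.le_add_left 1 m) x) (E.top m ξ) := by
    intro m x hx ξ
    have h1 := congrArg Prod.snd (hbL m x hx ξ)
    exact h1.trans (hTf _ _ ((E.incl_mem_part (Nat.le_add_left 1 m)).2 hx)).2
  have hb0 : ∀ (m : ℕ), ∀ x ∈ E.part U (m + 1), F.top (m + 1) (b m x) = f (E.top (m + 1) x) := by
    intro m x hx
    have h1 := congrArg (fun p => F.top 1 p.1) (hbL m x hx 0)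
    have h2 := (hTf _ (E.top m 0) ((E.incl_mem_part (Nat.le_add_left 1 m)).2 hx)).1
    have h3 := h1.trans h2
    rw [E.top_incl] at h3
    exact (F.top_incl (Nat.le_add_left 1 m) (b m x)).symm.trans h3
  -- `D'` is the sc-derivative of `Tf`. Its values at points outside of `U_2 ⊕ E_1` do not matter.
  set D' : E.X 2 × E.X 1 → (E.X 1 × E.X 0 →L[ℝ] F.X 1 × F.X 0) := fun p =>
    ((L 1 p.1).comp (ContinuousLinearMap.fst ℝ _ _)).prod
      (((H p.1).flip p.2).coprod (D (E.incl one_le_two p.1)))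
  have hHc : ContinuousOn (fun q : E.X 2 × E.X 1 × E.X 1 => H q.1 q.2.1 q.2.2)
      (E.part U 2 ×ˢ univ) := by
    refine (hB 0).congr fun q hq => ?_
    have h1 := hBH 0 q.1 hq.1 q.2.1 q.2.2
    rw [E.incl_self, E.incl_self, E.incl_self, F.top_zero] at h1
    exact h1.symm
  have hsc : IsScDeriv (E := E.tangent) (F := F.tangent) (E.tangentSet U) Tf D' := by
    rintro ⟨x, η⟩ hp
    have hx : x ∈ E.part U 2 := ScBanach.mem_part_tangentSet.1 hp
    rw [ScBanach.part_tangentSet]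
    have hfst : HasFDerivWithinAt (fun p : E.X 2 × E.X 1 => F.incl one_le_two (b 1 p.1))
        (((L 1 x).comp (E.incl one_le_two)).comp (ContinuousLinearMap.fst ℝ _ _))
        (E.part U 2 ×ˢ univ) (x, η) := by
      have h1 := hD.hasFDerivWithinAt_lift hU (f₁ := fun y => F.incl one_le_two (b 1 y))
        (fun y hy => (F.top_incl _ _).trans (hb0 1 y hy)) (hL0 1) (hL 1) hx
      exact h1.comp (t := E.part U 2) (x, η)
        (ContinuousLinearMap.fst ℝ (E.X 2) (E.X 1)).hasFDerivWithinAt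
        (fun q (hq : q ∈ E.part U 2 ×ˢ univ) => hq.1)
    have hsnd : HasFDerivWithinAt
        (fun p : E.X 2 × E.X 1 => (D (E.incl one_le_two p.1)).comp (E.top 1) p.2)
        ((((H x).flip η).comp (E.incl one_le_two)).coprod
          ((D (E.incl one_le_two x)).comp (E.top 1)))
        (E.part U 2 ×ˢ univ) (x, η) := by
      obtain ⟨O, C', hO, hC, -, h⟩ := hU.exists_part_eq 2
      have hd : ∀ η ∈ range (E.incl one_le_two), ∀ y ∈ E.part U 2, HasFDerivWithinAt
          (fun z => (D (E.incl one_le_two z)).comp (E.top 1) η)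
          (((H y).flip η).comp (E.incl one_le_two)) (E.part U 2) y := by
        rintro _ ⟨ζ, rfl⟩ y hy
        have h1 := (h2.2 y hy).hasFDerivWithinAt
        have h3 := ((ContinuousLinearMap.apply ℝ (F.X 0) ζ).hasFDerivAt
          (x := diff2 U f y)).comp_hasFDerivWithinAt y h1
        have h4 := h3.congr (f₁ := fun z => (D (E.incl one_le_two z)).comp (E.top 1)
            (E.incl one_le_two ζ)) (fun z hz => by
              simp [hD.diff2_eq hU hz, E.top_incl]) (by
              simp [hD.diff2_eq hU hy, E.top_incl])
        convert h4 using 1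
        ext ξ
        exact hH y hy ξ ζ
      rw [h] at hd hHc hx ⊢
      exact hasFDerivWithinAt_apply_of_dense hO hC
        (A := fun z => (D (E.incl one_le_two z)).comp (E.top 1)) (E.compact 1) hHc
        (E.denseRange_incl one_le_two) hd hx η
    have hTfeq : ∀ p ∈ E.part U 2 ×ˢ (univ : Set (E.X 1)),
        topDiag (E := E.tangent) (F := F.tangent) Tf 1 p =
          (F.incl one_le_two (b 1 p.1), (D (E.incl one_le_two p.1)).comp (E.top 1) p.2) :=
      fun p hp => (hbL 1 p.1 hp.1 p.2).symm.trans (Prod.ext rfl (hL0 1 p.1 hp.1 p.2))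
    have hfin := (hfst.prodMk hsnd).congr hTfeq (hTfeq _ ⟨hx, mem_univ _⟩)
    exact hfin.congr_fderiv (ContinuousLinearMap.ext fun p => rfl)
  have htop : ∀ p : E.X 2 × E.X 1, p.1 ∈ E.part U 2 →
      F.tangent.top 1 (b 1 p.1, L 1 p.1 p.2) = Tf (E.tangent.top 1 p) := fun p hp =>
    hbL 1 p.1 hp p.2
  refine ⟨hf, Tf, ⟨D, hD, hTf⟩, hT0, fun P => (((b 1 P.1.1, L 1 P.1.1 P.1.2)), D' P.1 P.2),
    ⟨D', hsc, fun p q hp => ⟨htop p (ScBanach.mem_part_tangentSet.1 hp), rfl⟩⟩, ?_, ?_⟩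
  · rintro ⟨p, q⟩ ⟨hp, -⟩
    refine ⟨?_, mem_univ _⟩
    have h1 : E.tangent.top 1 p ∈ E.tangentSet U := hp
    have h2 := hT0.1 h1
    rw [← htop p (ScBanach.mem_part_tangentSet.1 hp)] at h2
    exact h2
  · intro m
    refine ⟨fun P => ((b (m + 1) P.1.1, L (m + 1) P.1.1 P.1.2),
      (L (m + 1) P.1.1 P.2.1, B m P.1.1 P.2.1 P.1.2 +
        L m (E.incl (Nat.le_succ (m + 1)) P.1.1) P.2.2)), ?_, ?_⟩
    · rintro ⟨⟨x, η⟩, ξ, ζ⟩ hP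
      rw [ScBanach.part_tangentSet_tangentSet] at hP
      have hx : x ∈ E.part U (m + 2) := hP.1.1
      have h12 : 2 ≤ m + 2 := Nat.le_add_left 2 m
      have hx2 : E.incl h12 x ∈ E.part U 2 := (E.incl_mem_part h12).2 hx
      have hx1 : E.incl (Nat.le_succ (m + 1)) x ∈ E.part U (m + 1) := (E.incl_mem_part _).2 hx
      have h01 : 1 ≤ m + 1 := Nat.le_add_left 1 m
      refine Prod.ext (Prod.ext ?_ ?_) (Prod.ext ?_ ?_)
      · show F.incl h12 (b (m + 1) x) = b 1 (E.incl h12 x)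
        refine F.top_injective 2 ?_
        rw [F.top_incl]
        refine (hb0 (m + 1) x hx).trans ((hb0 1 _ hx2).trans ?_).symm
        rw [E.top_incl]
      · show F.incl h01 (L (m + 1) x η) = L 1 (E.incl h12 x) (E.incl h01 η)
        refine F.top_injective 1 ?_
        rw [F.top_incl, hL0 1 _ hx2, hL0 (m + 1) x hx, E.top_incl, E.incl_incl]
      · show F.incl h01 (L (m + 1) x ξ) = L 1 (E.incl h12 x) (E.incl h01 ξ)
        refine F.top_injective 1 ?_
        rw [F.top_incl, hL0 1 _ hx2, hL0 (m + 1) x hx, E.top_incl, E.incl_incl]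
      · show F.top m (B m x ξ η + L m (E.incl (Nat.le_succ (m + 1)) x) ζ) =
          H (E.incl h12 x) (E.incl h01 ξ) (E.incl h01 η) +
            D (E.incl one_le_two (E.incl h12 x)) (E.top m ζ)
        rw [map_add, hBH m x hx, hL0 m _ hx1, E.incl_incl, E.incl_incl]
    · rw [ScBanach.part_tangentSet_tangentSet]
      have hx1 : MapsTo (E.incl (Nat.le_succ (m + 1))) (E.part U (m + 2)) (E.part U (m + 1)) :=
        fun x hx => (E.incl_mem_part _).2 hx
      have e : Continuous fun P : (E.X (m + 2) × E.X (m + 1)) × (E.X (m + 1) × E.X m) => P.1.1 := by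
        fun_prop
      refine ContinuousOn.prodMk (ContinuousOn.prodMk ?_ ?_) (ContinuousOn.prodMk ?_ (.add ?_ ?_))
      · exact (hb (m + 1)).comp e.continuousOn fun P hP => hP.1.1
      · exact (hL (m + 1)).comp (f := fun P : (E.X (m + 2) × E.X (m + 1)) × (E.X (m + 1) × E.X m) =>
          (P.1.1, P.1.2)) (by fun_prop) fun P hP => ⟨hP.1.1, mem_univ _⟩
      · exact (hL (m + 1)).comp (f := fun P : (E.X (m + 2) × E.X (m + 1)) × (E.X (m + 1) × E.X m) =>
          (P.1.1, P.2.1)) (by fun_prop) fun P hP => ⟨hP.1.1, mem_univ _⟩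
      · exact (hB m).comp (f := fun P : (E.X (m + 2) × E.X (m + 1)) × (E.X (m + 1) × E.X m) =>
          (P.1.1, P.2.1, P.1.2)) (by fun_prop) fun P hP => ⟨hP.1.1, mem_univ _⟩
      · exact (hL m).comp (f := fun P : (E.X (m + 2) × E.X (m + 1)) × (E.X (m + 1) × E.X m) =>
          (E.incl (Nat.le_succ (m + 1)) P.1.1, P.2.2)) (by fun_prop)
          fun P hP => ⟨hx1 hP.1.1, mem_univ _⟩

/-! ### From the tangent map to the sc-Hessian -/

theorem IsSc2.exists_hessian {C U : Set (E.X 0)} {V : Set (F.X 0)}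
    (hU : IsScTriple E C U) {f : E.X 0 → F.X 0} (hf : IsSc2 U V f) :
    TwiceDiff U f ∧
        ∃ H : E.X 2 → (E.X 1 →L[ℝ] E.X 1 →L[ℝ] F.X 0),
          IsScHessian U f H ∧ HessianRestricts U H := by
  obtain ⟨-, Tf, ⟨D, hD, hTf⟩, hT0, TTf, ⟨D₂, hD₂, hTTf⟩, hTT0⟩ := hf
  -- `T x η` is `ξ ↦ D²f(x)(ξ, η)`, the partial derivative of `Tf` in the direction of the base.
  set T : E.X 2 → E.X 1 → (E.X 1 →L[ℝ] F.X 0) := fun x η =>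
    (ContinuousLinearMap.snd ℝ (F.X 1) (F.X 0)).comp
      ((D₂ (x, η)).comp (ContinuousLinearMap.inl ℝ (E.X 1) (E.X 0)))
  have hder : ∀ x ∈ E.part U 2, ∀ η : E.X 1, HasFDerivWithinAt
      (fun y => D (E.incl one_le_two y) (E.top 1 η)) ((T x η).comp (E.incl one_le_two))
      (E.part U 2) x := by
    intro x hx η
    have h1 := hD₂ (x, η) (ScBanach.mem_part_tangentSet.2 hx)
    rw [ScBanach.part_tangentSet] at h1
    have h2 := (ContinuousLinearMap.snd ℝ (F.X 1) (F.X 0)).hasFDerivAt.comp_hasFDerivWithinAt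
      (x, η) h1
    have h3 : HasFDerivWithinAt (fun y : E.X 2 => (y, η)) (ContinuousLinearMap.inl ℝ _ _)
        (E.part U 2) x := (hasFDerivWithinAt_id x _).prodMk (hasFDerivWithinAt_const η x _)
    have h4 := HasFDerivWithinAt.comp x h2 h3
      (show MapsTo _ _ (E.part U 2 ×ˢ univ) from fun y hy => ⟨hy, mem_univ _⟩)
    have hval : ∀ y ∈ E.part U 2, (Tf (E.tangent.top 1 (y, η))).2 =
        D (E.incl one_le_two y) (E.top 1 η) := fun y hy =>
      (hTf _ _ ((E.incl_mem_part one_le_two).2 hy)).2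
    refine (h4.congr (fun y hy => (hval y hy).symm) (hval x hx).symm).congr_fderiv ?_
    refine ContinuousLinearMap.ext fun h => ?_
    show (D₂ (x, η) (E.incl one_le_two h, E.top 1 0)).2 = (D₂ (x, η) (E.incl one_le_two h, 0)).2
    rw [map_zero]
  -- A bounded operator on `E_1` is determined by its restriction to the dense subspace `E_2`.
  have huniq : ∀ x ∈ E.part U 2, ∀ S S' : E.X 1 →L[ℝ] F.X 0, ∀ φ : E.X 2 → F.X 0,
      HasFDerivWithinAt φ (S.comp (E.incl one_le_two)) (E.part U 2) x →
      HasFDerivWithinAt φ (S'.comp (E.incl one_le_two)) (E.part U 2) x → S = S' := by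
    intro x hx S S' φ h h'
    have h1 := (hU.uniqueDiffOn 2 x hx).eq h h'
    refine ContinuousLinearMap.coeFn_injective
      ((E.denseRange_incl one_le_two).equalizer S.continuous S'.continuous ?_)
    exact congrArg DFunLike.coe h1
  have hTadd : ∀ x ∈ E.part U 2, ∀ η η', T x (η + η') = T x η + T x η' := by
    intro x hx η η'
    refine huniq x hx _ _ _ (hder x hx (η + η')) ?_
    refine ((hder x hx η).add (hder x hx η')).congr_fderiv ?_ |>.congr ?_ ?_
    · ext; rfl
    · intro y _; simp
    · simp
  have hTsmul : ∀ x ∈ E.part U 2, ∀ (c : ℝ) η, T x (c • η) = c • T x η := by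
    intro x hx c η
    refine huniq x hx _ _ _ (hder x hx (c • η)) ?_
    refine ((hder x hx η).const_smul c).congr_fderiv ?_ |>.congr ?_ ?_
    · ext; rfl
    · intro y _; simp
    · simp
  -- The second tangent map restricts to level `m`, so `(x, ξ, η) ↦ T x η ξ` takes values in `F_m`.
  have hex : ∀ m : ℕ, ∃ B : E.X (m + 2) → (E.X (m + 1) →L[ℝ] E.X (m + 1) →L[ℝ] F.X m),
      (∀ x ∈ E.part U (m + 2), ∀ ξ η : E.X (m + 1), F.top m (B x ξ η) =
        T (E.incl (Nat.le_add_left 2 m) x) (E.incl (Nat.le_add_left 1 m) η)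
          (E.incl (Nat.le_add_left 1 m) ξ)) ∧
      ContinuousOn (fun p : E.X (m + 2) × E.X (m + 1) × E.X (m + 1) => B p.1 p.2.1 p.2.2)
        (E.part U (m + 2) ×ˢ univ) := by
    intro m
    obtain ⟨g, hg, hgc⟩ := hTT0.2 m
    rw [ScBanach.part_tangentSet_tangentSet] at hg hgc
    set b : E.X (m + 2) → E.X (m + 1) → E.X (m + 1) → F.X m := fun x ξ η =>
      (g ((x, η), (ξ, 0))).2.2
    have hbT : ∀ x ∈ E.part U (m + 2), ∀ ξ η : E.X (m + 1), F.top m (b x ξ η) =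
        T (E.incl (Nat.le_add_left 2 m) x) (E.incl (Nat.le_add_left 1 m) η)
          (E.incl (Nat.le_add_left 1 m) ξ) := by
      intro x hx ξ η
      have h1 := congrArg (fun q => q.2.2) (hg ((x, η), (ξ, 0)) ⟨⟨hx, mem_univ _⟩, mem_univ _⟩)
      have h2 := (hTTf (E.incl (Nat.le_add_left 2 m) x, E.incl (Nat.le_add_left 1 m) η)
        (E.incl (Nat.le_add_left 1 m) ξ, E.top m 0)
        (ScBanach.mem_part_tangentSet.2 ((E.incl_mem_part (Nat.le_add_left 2 m)).2 hx))).2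
      refine (h1.trans (congrArg Prod.snd h2)).trans ?_
      rw [map_zero]
      rfl
    have hbc : ContinuousOn (fun p : E.X (m + 2) × E.X (m + 1) × E.X (m + 1) =>
        b p.1 p.2.1 p.2.2) (E.part U (m + 2) ×ˢ univ) :=
      ((continuous_snd.comp continuous_snd).comp_continuousOn hgc).comp
        (f := fun p : E.X (m + 2) × E.X (m + 1) × E.X (m + 1) =>
          ((p.1, p.2.2), (p.2.1, (0 : E.X m)))) (by fun_prop)
        fun p hp => ⟨⟨hp.1, mem_univ _⟩, mem_univ _⟩
    have hexB : ∀ x : E.X (m + 2), ∃ B : E.X (m + 1) →L[ℝ] E.X (m + 1) →L[ℝ] F.X m,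
        x ∈ E.part U (m + 2) → ∀ ξ η, B ξ η = b x ξ η := by
      intro x
      by_cases hx : x ∈ E.part U (m + 2)
      · have hx2 := (E.incl_mem_part (Nat.le_add_left 2 m)).2 hx
        have hc : Continuous fun p : E.X (m + 1) × E.X (m + 1) => b x p.1 p.2 :=
          continuousOn_univ.1 (hbc.comp (f := fun p : E.X (m + 1) × E.X (m + 1) => (x, p))
            (by fun_prop) fun p _ => ⟨hx, mem_univ _⟩)
        obtain ⟨B, hB⟩ := exists_continuousLinearMap₂_of_continuous
          (fun ξ ξ' η => F.top_injective m (by rw [map_add]; simp only [hbT x hx, map_add]))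
          (fun c ξ η => F.top_injective m (by rw [map_smul]; simp only [hbT x hx, map_smul]))
          (fun ξ η η' => F.top_injective m (by
            rw [map_add]; simp only [hbT x hx, map_add, hTadd _ hx2, add_apply]))
          (fun c ξ η => F.top_injective m (by
            rw [map_smul]; simp only [hbT x hx, map_smul, hTsmul _ hx2, smul_apply]))
          hc
        exact ⟨B, fun _ => hB⟩
      · exact ⟨0, fun h => absurd h hx⟩
    choose B hB using hexB
    refine ⟨B, fun x hx ξ η => ?_, hbc.congr fun p hp => hB p.1 hp.1 p.2.1 p.2.2⟩
    rw [hB x hx, hbT x hx]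
  choose B hBT hBc using hex
  set H : E.X 2 → (E.X 1 →L[ℝ] E.X 1 →L[ℝ] F.X 0) := B 0
  have hHT : ∀ x ∈ E.part U 2, ∀ ξ η, H x ξ η = T x η ξ := by
    intro x hx ξ η
    have h1 := hBT 0 x hx ξ η
    rwa [E.incl_self, E.incl_self, E.incl_self, F.top_zero] at h1
  have hHc : ContinuousOn (fun q : E.X 2 × E.X 1 × E.X 1 => H q.1 q.2.1 q.2.2)
      (E.part U 2 ×ˢ univ) := hBc 0
  set G : E.X 2 → (E.X 2 →L[ℝ] E.X 2 →L[ℝ] F.X 0) := fun x =>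
    (((E.incl one_le_two).precomp (F.X 0)).comp (H x)).comp (E.incl one_le_two)
  -- Both arguments of `H x` pass through the compact inclusion `E_2 → E_1`.
  have hGc : ContinuousOn G (E.part U 2) := by
    refine continuousOn_comp_of_isCompactOperator (E.compact 1) ?_
    refine continuousOn_comp_of_isCompactOperator (E.compact 1)
      (Φ := fun p : E.X 2 × E.X 1 => H p.1 p.2) ?_
    exact hHc.comp (f := fun q : (E.X 2 × E.X 1) × E.X 1 => (q.1.1, q.1.2, q.2)) (by fun_prop)
      fun q hq => ⟨hq.1.1, mem_univ _⟩
  have hdiff : ∀ x ∈ E.part U 2, HasFDerivWithinAt (diff2 U f) (G x) (E.part U 2) x := by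
    intro x hx
    have hd : ∀ ζ : E.X 2, ∀ y ∈ E.part U 2, HasFDerivWithinAt
        (fun z => ContinuousLinearMap.apply ℝ (F.X 0) ζ (diff2 U f z))
        ((ContinuousLinearMap.apply ℝ (F.X 0) ζ).comp (G y)) (E.part U 2) y := by
      intro ζ y hy
      refine ((hder y hy (E.incl one_le_two ζ)).congr_fderiv ?_).congr ?_ ?_
      · refine ContinuousLinearMap.ext fun ξ => ?_
        exact (hHT y hy _ _).symm
      · intro z hz
        simp [hD.diff2_eq hU hz, E.top_incl]
      · simp [hD.diff2_eq hU hy, E.top_incl]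
    obtain ⟨O, C', hO, hC, -, h⟩ := hU.exists_part_eq 2
    rw [h] at hd hGc hx ⊢
    exact hasFDerivWithinAt_of_separating hO hC hGc
      (fun ζ => ContinuousLinearMap.apply ℝ (F.X 0) ζ)
      (fun L hL => ContinuousLinearMap.ext hL) hd hx
  refine ⟨⟨fun x hx => (hD.hasFDerivWithinAt_topDiag_two hx).differentiableWithinAt,
    fun x hx => (hdiff x hx).differentiableWithinAt⟩, H, fun x hx ξ η => ?_, fun m =>
    ⟨B m, fun x hx ξ η => ?_, hBc m⟩⟩
  · rw [secondDeriv, (hdiff x hx).fderivWithin (hU.uniqueDiffOn 2 x hx)]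
    rfl
  · rw [hBT m x hx, hHT _ ((E.incl_mem_part (Nat.le_add_left 2 m)).2 hx)]

end maps

/-- Characterization of the class sc² through the sc-Hessian. -/
theorem lemma2p3 (E : ScBanach.{u}) (F : ScBanach.{v})
    (C U : Set (E.X 0)) (D V : Set (F.X 0))
    (hU : IsScTriple E C U) (hV : IsScTriple F D V)
    (f : E.X 0 → F.X 0) (hf : IsSc1 U V f) :
    IsSc2 U V f ↔
      TwiceDiff U f ∧
        ∃ H : E.X 2 → (E.X 1 →L[ℝ] E.X 1 →L[ℝ] F.X 0),
          IsScHessian U f H ∧ HessianRestricts U H :=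
  ⟨fun h => h.exists_hessian hU, fun ⟨h2, _, hH, hR⟩ => hf.isSc2_of_hessian hU h2 hH hR⟩
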